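/- Let $\mathfrak{s}$ be a finite-dimensional semisimple real Lie algebra, let $\mathfrak{r}$ be an arbitrary real Lie algebra, and let $\mathfrak{g}=\mathfrak{s}\oplus\mathfrak{r}$ be their direct sum as Lie algebras (so $[\mathfrak{s},\mathfrak{r}]=0$). Then there is an isomorphism of real vector spaces $$H^{2}(\mathfrak{g},\mathfrak{g})\;\simeq\;H^{2}(\mathfrak{r},\mathfrak{r}).$$ Here, for a real Lie algebra $L$, $H^2(L,L)=Z^2(L,L)/B^2(L,L)$ denotes the second cohomology space with coefficients in the adjoint module: $Z^2(L,L)$ is the space of alternating bilinear maps $\varphi:L\times L\to L$ such that $$[x,\varphi(y,z)]-[y,\varphi(x,z)]+[z,\varphi(x,y)]-\varphi([x,y],z)+\varphi([x,z],y)-\varphi([y,z],x)=0\qquad(x,y,z\in L),$$ and $B^2(L,L)$ is the subspace of the maps $(x,y)\mapsto[x,f(y)]-[y,f(x)]-f([x,y])$ with $f:L\to L$ linear. -/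

import Mathlib

set_option maxSynthPendingDepth 3

namespace LieAdjointCohomology

open LieModule.Cohomology

section

variable (R : Type*) [CommRing R]
variable (L : Type*) [LieRing L] [LieAlgebra R L]
variable (M : Type*) [AddCommGroup M] [Module R M] [LieRingModule L M] [LieModule R L M]

/-- The 2-coboundaries `B²(L, M)`: the 2-cochains of the form
`(x, y) ↦ ⁅x, f y⁆ - ⁅y, f x⁆ - f ⁅x, y⁆` for a linear map `f : L → M`. -/
def twoCoboundary : Submodule R (twoCochain R L M) :=
  LinearMap.range (d₁₂ R L M)

/-- Every 2-coboundary is a 2-cocycle: `B²(L, M) ⊆ Z²(L, M)`. -/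
theorem twoCoboundary_le_twoCocycle : twoCoboundary R L M ≤ twoCocycle R L M := by
  rintro _ ⟨f, rfl⟩
  rw [mem_twoCocycle_iff]
  exact LinearMap.congr_fun (d₂₃_comp_d₁₂ R L M) f

/-- The second cohomology space `H²(L, M) = Z²(L, M) / B²(L, M)` of the Lie algebra `L` with
coefficients in the `L`-module `M`. For `M = L` the coefficients are the adjoint module. -/
abbrev H2 : Type _ :=
  twoCocycle R L M ⧸ (twoCoboundary R L M).submoduleOf (twoCocycle R L M)

end

end LieAdjointCohomology

/-! Inclusion of `r` and projection to `r` induce maps between `H²(g, g)` and `H²(r, r)`; one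
composite is the identity already on cochains. For the other, every cocycle must differ from its `r
× r → r` block by a coboundary. The Casimir tensor `∑ bᵢ ⊗ cᵢ` of `s` is invariant and acts on `s`
as the identity, so contracting with it gives explicit primitives: `casimirFst` for the `s`-valued
part, `casimirSnd` for the `r`-valued part on `s × s`. Since `s` is perfect, the latter also settles
the mixed block. -/

namespace LieAdjointCohomology

open LieModule.Cohomology

section DualBases

variable {K L M ι : Type*} [Field K] [LieRing L] [LieAlgebra K L] [AddCommGroup M] [Module K M]
variable [Fintype ι]

/-- Two bases of a Lie algebra are Killing dual if each computes the coordinates with respect to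
the other through the Killing form. -/
structure IsKillingDual (b c : Module.Basis ι K L) : Prop where
  repr_left (x : L) (i : ι) : b.repr x i = killingForm K L x (c i)
  repr_right (x : L) (i : ι) : c.repr x i = killingForm K L x (b i)

theorem exists_isKillingDual (K L : Type*) [Field K] [LieRing L] [LieAlgebra K L]
    [FiniteDimensional K L] [LieAlgebra.IsKilling K L] :
    ∃ b c : Module.Basis (Fin (Module.finrank K L)) K L, IsKillingDual b c := by
  have hκ := LieAlgebra.IsKilling.killingForm_nondegenerate K L
  have hsymm : LinearMap.BilinForm.IsSymm (killingForm K L) :=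
    ⟨LieModule.traceForm_comm K L L⟩
  let b := Module.finBasis K L
  refine ⟨b, LinearMap.BilinForm.dualBasis _ hκ b, fun x i ↦ ?_, fun x i ↦ ?_⟩
  · conv_lhs => rw [← LinearMap.BilinForm.dualBasis_dualBasis hκ hsymm b]
    exact LinearMap.BilinForm.dualBasis_repr_apply hκ _ x i
  · exact LinearMap.BilinForm.dualBasis_repr_apply hκ _ x i

namespace IsKillingDual

variable {b c : Module.Basis ι K L} (h : IsKillingDual b c)
include h

/-- The tensor `∑ bᵢ ⊗ cᵢ` is invariant. -/
theorem sum_lie_left (B : L →ₗ[K] L →ₗ[K] M) (y : L) :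
    ∑ i, B ⁅b i, y⁆ (c i) = -∑ i, B (b i) ⁅c i, y⁆ := by
  have h₁ (i : ι) : B ⁅b i, y⁆ (c i) =
      ∑ j, killingForm K L ⁅b i, y⁆ (c j) • B (b j) (c i) := by
    conv_lhs => rw [← b.sum_repr ⁅b i, y⁆]
    simp [h.repr_left]
  have h₂ (i : ι) : B (b i) ⁅c i, y⁆ =
      ∑ j, killingForm K L ⁅c i, y⁆ (b j) • B (b i) (c j) := by
    conv_lhs => rw [← c.sum_repr ⁅c i, y⁆]
    simp [h.repr_right]
  simp_rw [h₁, h₂]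
  rw [Finset.sum_comm, ← Finset.sum_neg_distrib]
  refine Finset.sum_congr rfl fun j _ ↦ ?_
  rw [← Finset.sum_neg_distrib]
  refine Finset.sum_congr rfl fun i _ ↦ ?_
  rw [← neg_smul, LieModule.traceForm_apply_lie_apply, ← lie_skew, map_neg,
    LieModule.traceForm_comm]

/-- The Casimir element of the Killing form acts on the adjoint module as the identity. -/
theorem sum_lie_lie (x : L) : ∑ i, ⁅b i, ⁅c i, x⁆⁆ = x := by
  classical
  refine b.ext_elem fun j ↦ ?_
  generalize hy : c j = y
  -- Summed over `i`, the right side is the trace of `ad x ∘ ad y` in the basis `b`, that is `κ(x,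
  -- y)`.
  have key (i : ι) : killingForm K L ⁅b i, ⁅c i, x⁆⁆ y = killingForm K L ⁅x, ⁅y, b i⁆⁆ (c i) := by
    rw [LieModule.traceForm_apply_lie_apply, LieModule.traceForm_comm,
      LieModule.traceForm_apply_lie_apply, LieModule.traceForm_apply_lie_apply,
      LieModule.traceForm_comm]
  rw [h.repr_left, h.repr_left, hy, map_sum, LinearMap.sum_apply, killingForm_apply_apply,
    LinearMap.trace_eq_matrix_trace K b, Matrix.trace]
  refine Finset.sum_congr rfl fun i _ ↦ ?_
  rw [key, Matrix.diag_apply, LinearMap.toMatrix_apply, h.repr_left]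
  rfl

end IsKillingDual

end DualBases

section Functoriality

variable {R L L' M M' : Type*} [CommRing R] [LieRing L] [LieAlgebra R L] [LieRing L']
  [LieAlgebra R L'] [AddCommGroup M] [Module R M] [AddCommGroup M'] [Module R M']

/-- The map on 2-cochains given by pulling back along `p` and pushing forward along `q`. -/
def twoCochainMap (p : L' →ₗ⁅R⁆ L) (q : M →ₗ[R] M') :
    twoCochain R L M →ₗ[R] twoCochain R L' M' where
  toFun a := ⟨(a.1.compl₁₂ (p : L' →ₗ[R] L) (p : L' →ₗ[R] L)).compr₂ q, fun x ↦ by simp⟩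
  map_add' a b := by ext; simp
  map_smul' t a := by ext; simp

@[simp]
theorem twoCochainMap_apply_apply (p : L' →ₗ⁅R⁆ L) (q : M →ₗ[R] M') (a : twoCochain R L M)
    (x y : L') : twoCochainMap p q a x y = q (a (p x) (p y)) :=
  rfl

variable [LieRingModule L M] [LieModule R L M] [LieRingModule L' M'] [LieModule R L' M']
  (p : L' →ₗ⁅R⁆ L) (q : M →ₗ[R] M') (hpq : ∀ x m, q ⁅p x, m⁆ = ⁅x, q m⁆)

include hpq in
theorem twoCochainMap_mem_twoCocycle {a : twoCochain R L M} (ha : a ∈ twoCocycle R L M) :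
    twoCochainMap p q a ∈ twoCocycle R L' M' := by
  rw [mem_twoCocycle_iff] at ha ⊢
  ext x y z
  have := congr(q ($ha (p x) (p y) (p z)))
  simpa [hpq] using this

include hpq in
theorem twoCochainMap_d₁₂ (f : oneCochain R L M) :
    twoCochainMap p q (d₁₂ R L M f) = d₁₂ R L' M' (q ∘ₗ f ∘ₗ (p : L' →ₗ[R] L)) := by
  ext x y
  simp [hpq]

/-- The map on second cohomology induced by a compatible pair of a Lie algebra homomorphism and
a linear map of coefficients. -/
def H2Map : H2 R L M →ₗ[R] H2 R L' M' :=
  Submodule.mapQ _ _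
    ((twoCochainMap p q).restrict fun _ ha ↦ twoCochainMap_mem_twoCocycle p q hpq ha) <| by
      rintro ⟨_, _⟩ ⟨f, rfl⟩
      exact ⟨q ∘ₗ f ∘ₗ (p : L' →ₗ[R] L), (twoCochainMap_d₁₂ p q hpq f).symm⟩

end Functoriality

section Prod

variable {K s r ι : Type*} [Field K] [LieRing s] [LieAlgebra K s] [LieRing r] [LieAlgebra K r]
  [Fintype ι] {b c : Module.Basis ι K s}

theorem twoCocycle_apply {R L M : Type*} [CommRing R] [LieRing L] [LieAlgebra R L]
    [AddCommGroup M] [Module R M] [LieRingModule L M] [LieModule R L M] {a : twoCochain R L M}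
    (ha : a ∈ twoCocycle R L M) (x y z : L) :
    ⁅x, a y z⁆ - ⁅y, a x z⁆ + ⁅z, a x y⁆ - a ⁅x, y⁆ z + a ⁅x, z⁆ y - a ⁅y, z⁆ x = 0 := by
  rw [mem_twoCocycle_iff] at ha
  exact congr($ha x y z)

/-- The contraction of the `s`-component of a 2-cochain with the Casimir element. -/
noncomputable def casimirFst (b c : Module.Basis ι K s) (a : twoCochain K (s × r) (s × r)) :
    s × r →ₗ[K] s :=
  ∑ i, (LieAlgebra.ad K s (b i)) ∘ₗ LinearMap.fst K s r ∘ₗ a (c i, 0)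

/-- The contraction of the `r`-component of a 2-cochain with the Casimir element. -/
noncomputable def casimirSnd (b c : Module.Basis ι K s) (a : twoCochain K (s × r) (s × r)) :
    s →ₗ[K] r :=
  ∑ i, LinearMap.snd K s r ∘ₗ a (b i, 0) ∘ₗ LinearMap.inl K s r ∘ₗ LieAlgebra.ad K s (c i)

theorem casimirFst_apply (a : twoCochain K (s × r) (s × r)) (x : s × r) :
    casimirFst b c a x = ∑ i, ⁅b i, (a (c i, 0) x).1⁆ := by
  simp [casimirFst]

theorem casimirSnd_apply (a : twoCochain K (s × r) (s × r)) (x : s) :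
    casimirSnd b c a x = ∑ i, (a (b i, 0) (⁅c i, x⁆, 0)).2 := by
  simp [casimirSnd]

/-- `H²(s × r, s) = 0`, in explicit form. -/
theorem fst_apply_eq (h : IsKillingDual b c) {a : twoCochain K (s × r) (s × r)}
    (ha : a ∈ twoCocycle K (s × r) (s × r)) (y z : s × r) :
    (a y z).1 = ⁅y.1, casimirFst b c a z⁆ - ⁅z.1, casimirFst b c a y⁆ -
      casimirFst b c a ⁅y, z⁆ := by
  have inv (y z : s × r) : ∑ i, ⁅⁅b i, y.1⁆, (a (c i, 0) z).1⁆ =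
      -∑ i, ⁅b i, (a ⁅((c i, 0) : s × r), y⁆ z).1⁆ := by
    simpa using h.sum_lie_left ((LieModule.toEnd K s s : s →ₗ[K] s →ₗ[K] s).compl₂
      (LinearMap.fst K s r ∘ₗ a.1.flip z ∘ₗ LinearMap.inl K s r)) y.1
  have key (i : ι) : ⁅b i, ⁅c i, (a y z).1⁆⁆ =
      ⁅y.1, ⁅b i, (a (c i, 0) z).1⁆⁆ + ⁅⁅b i, y.1⁆, (a (c i, 0) z).1⁆ -
      (⁅z.1, ⁅b i, (a (c i, 0) y).1⁆⁆ + ⁅⁅b i, z.1⁆, (a (c i, 0) y).1⁆) +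
      ⁅b i, (a ⁅((c i, 0) : s × r), y⁆ z).1⁆ - ⁅b i, (a ⁅((c i, 0) : s × r), z⁆ y).1⁆ -
      ⁅b i, (a (c i, 0) ⁅y, z⁆).1⁆ := by
    have hi := congr(⁅b i, (Prod.fst $(twoCocycle_apply ha (c i, 0) y z))⁆)
    rw [← twoCochain_skew a (c i, 0) ⁅y, z⁆] at hi
    simp only [Prod.fst_sub, Prod.fst_add, Prod.fst_neg, Prod.fst_zero, lie_sub, lie_add, lie_neg,
      lie_zero, LieAlgebra.Prod.bracket_apply y (_ : s × r),
      LieAlgebra.Prod.bracket_apply z (_ : s × r),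
      LieAlgebra.Prod.bracket_apply (c i, 0) (a y z)] at hi
    rw [leibniz_lie (b i) y.1, leibniz_lie (b i) z.1] at hi
    simp only [LieAlgebra.Prod.bracket_apply] at hi ⊢
    rw [← sub_eq_zero, ← hi]
    abel
  rw [← h.sum_lie_lie (a y z).1, Finset.sum_congr rfl fun i _ ↦ key i]
  simp only [Finset.sum_add_distrib, Finset.sum_sub_distrib, inv, casimirFst_apply, lie_sum]
  abel

/-- `H²(s, r) = 0` for trivial coefficients, in explicit form. -/
theorem snd_apply_inl_inl (h : IsKillingDual b c) {a : twoCochain K (s × r) (s × r)}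
    (ha : a ∈ twoCocycle K (s × r) (s × r)) (y z : s) :
    (a (y, 0) (z, 0)).2 = casimirSnd b c a ⁅y, z⁆ := by
  let B : s →ₗ[K] s →ₗ[K] r := (a.1.compl₁₂ (LinearMap.inl K s r) (LinearMap.inl K s r)).compr₂
    (LinearMap.snd K s r)
  have skew (x y : s) : B x y = -B y x := congr(Prod.snd $((twoCochain_skew a (y, 0) (x, 0)).symm))
  -- No action terms survive, since `s` acts trivially on `r`.
  have hB (x y z : s) : B x ⁅y, z⁆ = B y ⁅x, z⁆ - B ⁅y, x⁆ z := by
    have hi := congr(Prod.snd $(twoCocycle_apply ha (x, 0) (y, 0) (z, 0)))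
    simp only [LieAlgebra.Prod.bracket_apply, Prod.snd_sub, Prod.snd_add, zero_lie, sub_zero,
      add_zero, zero_sub, Prod.snd_zero] at hi
    change -B ⁅x, y⁆ z + B ⁅x, z⁆ y - B ⁅y, z⁆ x = 0 at hi
    rw [skew _ y, skew _ x, ← lie_skew, map_neg, LinearMap.neg_apply] at hi
    rw [← sub_eq_zero, ← hi]
    abel
  have inv : ∑ i, B ⁅y, b i⁆ ⁅c i, z⁆ = ∑ i, B (b i) ⁅⁅c i, y⁆, z⁆ := by
    have := h.sum_lie_left (B.compl₂ ((LieAlgebra.ad K s : s →ₗ[K] s →ₗ[K] s).flip z)) y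
    simp only [LinearMap.compl₂_apply, LinearMap.flip_apply, LieHom.coe_toLinearMap,
      LieAlgebra.ad_apply] at this
    simp only [← lie_skew y, map_neg, LinearMap.neg_apply, Finset.sum_neg_distrib, this, neg_neg]
  rw [casimirSnd_apply]
  change B y z = ∑ i, B (b i) ⁅c i, ⁅y, z⁆⁆
  simp only [leibniz_lie (c _) y z, map_add, hB (b _) y, Finset.sum_add_distrib,
    Finset.sum_sub_distrib, inv, ← map_sum, h.sum_lie_lie]
  abel

/-- The mixed components of an `r`-valued 2-cocycle are those of a coboundary, as `s` is perfect. -/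
theorem snd_apply_inl_inr (h : IsKillingDual b c) {a : twoCochain K (s × r) (s × r)}
    (ha : a ∈ twoCocycle K (s × r) (s × r)) (y : s) (z : r) :
    (a (y, 0) (0, z)).2 = ⁅z, casimirSnd b c a y⁆ := by
  let F : s →ₗ[K] r := LinearMap.snd K s r ∘ₗ a.1.flip (0, z) ∘ₗ LinearMap.inl K s r
  have hF (x y : s) : F ⁅x, y⁆ = ⁅z, casimirSnd b c a ⁅x, y⁆⁆ := by
    have hi := congr(Prod.snd $(twoCocycle_apply ha (x, 0) (y, 0) (0, z)))
    simp only [LieAlgebra.Prod.bracket_apply, Prod.snd_sub, Prod.snd_add, zero_lie, lie_zero,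
      sub_zero, add_zero, zero_add, Prod.snd_zero, Prod.mk_zero_zero, map_zero, sub_self,
      LinearMap.zero_apply, snd_apply_inl_inl h ha] at hi
    change _ - F ⁅x, y⁆ = 0 at hi
    exact (sub_eq_zero.mp hi).symm
  change F y = _
  -- The Casimir identity writes `y` as a sum of brackets, where `hF` applies.
  rw [← h.sum_lie_lie y]
  simp only [map_sum, lie_sum, hF]

/-- The subtracted term is the `r × r → r` block; the three preceding lemmas account for everything
else. -/
theorem sub_twoCochainMap_eq_d₁₂ (h : IsKillingDual b c) {a : twoCochain K (s × r) (s × r)}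
    (ha : a ∈ twoCocycle K (s × r) (s × r)) :
    a - twoCochainMap (LieHom.snd K s r) (LinearMap.inr K s r)
        (twoCochainMap (LieHom.inr K s r) (LinearMap.snd K s r) a) =
      d₁₂ K (s × r) (s × r)
        ((casimirFst b c a).prod (-(casimirSnd b c a ∘ₗ LinearMap.fst K s r))) := by
  ext1
  refine LinearMap.ext₂ fun x y ↦ Prod.ext ?_ ?_
  · have := fst_apply_eq h ha x y
    simpa using this
  · have hx : x = (x.1, 0) + (0, x.2) := by simp
    have hy : y = (y.1, 0) + (0, y.2) := by simp
    have h₁ := snd_apply_inl_inl h ha x.1 y.1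
    have h₂ := snd_apply_inl_inr h ha x.1 y.2
    have h₃ := snd_apply_inl_inr h ha y.1 x.2
    rw [← twoCochain_skew] at h₃
    have h₄ : a x y = a (x.1, 0) (y.1, 0) + a (x.1, 0) (0, y.2) + (a (0, x.2) (y.1, 0) +
        a (0, x.2) (0, y.2)) := by
      conv_lhs => rw [hx, hy]
      simp only [map_add, LinearMap.add_apply]
      abel
    simp only [Prod.snd_neg, neg_eq_iff_eq_neg] at h₃
    simp [h₄, h₁, h₂, h₃, -lie_skew]
    abel

end Prod

end LieAdjointCohomology

/-- For a finite-dimensional semisimple real Lie algebra `s` and an arbitrary real Lie algebra `r`,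
the direct sum `g = s ⊕ r` (the product, with componentwise bracket) satisfies
`H²(g, g) ≅ H²(r, r)` as real vector spaces, with adjoint coefficients on both sides. -/
theorem proposition1 (s r : Type*)
    [LieRing s] [LieAlgebra ℝ s] [FiniteDimensional ℝ s] [LieAlgebra.IsSemisimple ℝ s]
    [LieRing r] [LieAlgebra ℝ r] :
    Nonempty (LieAdjointCohomology.H2 ℝ (s × r) (s × r) ≃ₗ[ℝ] LieAdjointCohomology.H2 ℝ r r) := by
  -- Semisimplicity enters only here, through nondegeneracy of the Killing form (Cartan's
  -- criterion).
  obtain ⟨b, c, h⟩ := LieAdjointCohomology.exists_isKillingDual ℝ s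
  refine ⟨LinearEquiv.ofLinearMap
    (LieAdjointCohomology.H2Map (LieHom.inr ℝ s r) (LinearMap.snd ℝ s r) fun x m ↦ rfl)
    (LieAdjointCohomology.H2Map (LieHom.snd ℝ s r) (LinearMap.inr ℝ s r) fun x m ↦ ?_) ?_ ?_⟩
  · simp
  · refine Submodule.linearMap_qext _ (LinearMap.ext fun a ↦ ?_)
    rfl
  · refine Submodule.linearMap_qext _ (LinearMap.ext fun a ↦ ?_)
    refine ((Submodule.Quotient.eq _).mpr ?_).symm
    exact ⟨_, (LieAdjointCohomology.sub_twoCochainMap_eq_d₁₂ h a.2).symm⟩
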